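/- A digraph $D=(V,A)$ has a finite vertex set $V$ and a finite set $A$ of arcs, each arc having an origin and a target in $V$ (loops and multiple arcs are allowed). A mixed graph is a digraph $D=(V,A)$ together with a partition $E$ of $A$ into singletons (oriented edges) and doubletons consisting of two opposite arcs (unoriented edges). Let $c(D)$ be the number of connected components of the underlying graph, and for $S\subseteq A$ let $D_{\setminus S}$ be the digraph obtained by deleting the arcs in $S$; a digraph is acyclic if it has no directed cycle (a loop is a directed cycle). Let $B_D(q,y,z)$ be the unique polynomial such that for every positive integer $q$, $$B_D(q,y,z)=\sum_{f:V\to\{1,\dots,q\}} y^{\#\{(u,v)\in A:\ f(u)<f(v)\}}\,z^{\#\{(u,v)\in A:\ f(u)>f(v)\}},$$ and let $$T^{(1)}_D(x,y)=\frac{y^{|E|}}{(y-1)^{|V|}(x-1)^{c(D)}}\,B_D\!\left((x-1)(y-1),\tfrac1y,1\right).$$ Theorem. For every mixed graph $D$, the rational function $T^{(1)}_D(x,y)$ is a polynomial in $x$ and $y$ with rational coefficients, and $$(y+1)^{|E|+c(D)-|V|}\;T^{(1)}_D\!\left(y+2,\frac{y}{y+1}\right)=\sum_{\substack{S\subseteq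 A\\ D_{\setminus S}\text{ acyclic}}} y^{|E|-|A\setminus S|},$$ both as an identity in the field $\mathbb{Q}(y)$ of rational functions and for every $y\neq -1$ in a field of characteristic zero (including $y=0$). -/

import Mathlib

/-- A directed multigraph: `V` is the set of vertices, `A` the set of arcs,
and every arc has an origin and a target. Loops and multiple arcs are allowed. -/
structure MultiDigraph (V A : Type*) where
  origin : A → V
  target : A → V

namespace MultiDigraph

variable {V A : Type*}

/-- The arcs `a` and `b` are opposite: `a = (u, v)` and `b = (v, u)`. -/
def IsOpposite (D : MultiDigraph V A) (a b : A) : Prop :=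
  D.origin a = D.target b ∧ D.target a = D.origin b

/-- There is an arc from `u` to `v`. -/
def HasArc (D : MultiDigraph V A) (u v : V) : Prop :=
  ∃ a, D.origin a = u ∧ D.target a = v

/-- `D` has no directed cycle: there is no directed walk of positive length from a vertex to
itself. (A loop is a directed cycle.) -/
def IsAcyclic (D : MultiDigraph V A) : Prop :=
  ∀ v, ¬ Relation.TransGen D.HasArc v v

/-- The digraph `D ∖ S` obtained by deleting the arcs in `S`. -/
def delete (D : MultiDigraph V A) (S : Finset A) : MultiDigraph V {a : A // a ∉ S} where
  origin a := D.origin a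
  target a := D.target a

/-- The number of connected components of the graph underlying `D`. -/
noncomputable def numComponents (D : MultiDigraph V A) : ℕ :=
  Nat.card (SimpleGraph.fromRel D.HasArc).ConnectedComponent

/-- The number of ascents of the coloring `f`, i.e. of arcs `(u, v)` with `f u < f v`. -/
def numAscents [Fintype A] (D : MultiDigraph V A) {q : ℕ} (f : V → Fin q) : ℕ :=
  (Finset.univ.filter fun a => f (D.origin a) < f (D.target a)).card

/-- The number of descents of the coloring `f`, i.e. of arcs `(u, v)` with `f u > f v`. -/
def numDescents [Fintype A] (D : MultiDigraph V A) {q : ℕ} (f : V → Fin q) : ℕ :=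
  (Finset.univ.filter fun a => f (D.target a) < f (D.origin a)).card

open MvPolynomial in
open scoped Classical in
/-- `B(q, y, z)` is a trivariate polynomial such that for every positive integer `q`, as
polynomials in `y, z`,
`B(q, y, z) = ∑_{f : V → [q]} y ^ (number of ascents of f) * z ^ (number of descents of f)`. -/
def IsBPolynomial [Fintype V] [Fintype A] (D : MultiDigraph V A)
    (B : MvPolynomial (Fin 3) ℚ) : Prop :=
  ∀ q : ℕ, 0 < q →
    aeval (![(q : MvPolynomial (Fin 2) ℚ), X 0, X 1]) B =
      ∑ f : V → Fin q, X 0 ^ D.numAscents f * X 1 ^ D.numDescents f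

open scoped Classical in
theorem sum_colorings [Fintype V] [Fintype A] {R : Type*} [CommRing R]
    (D : MultiDigraph V A) (q : ℕ) (y z : R) :
    ∑ f : V → Fin q, y ^ D.numAscents f * z ^ D.numDescents f =
      ∑ p ∈ Finset.range (Fintype.card V + 1), q.choose p •
        ∑ g : V → Fin p with Function.Surjective g,
          y ^ D.numAscents g * z ^ D.numDescents g := by
  set h : ℕ → R := fun p => ∑ g : V → Fin p with Function.Surjective g,
    y ^ D.numAscents g * z ^ D.numDescents g with hh
  have key : ∀ S : Finset (Fin q),
      ∑ f : V → Fin q with Finset.univ.image f = S, y ^ D.numAscents f * z ^ D.numDescents f =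
        h S.card := by
    intro S
    symm
    have hmono := (S.orderEmbOfFin rfl).strictMono
    refine Finset.sum_bij (fun g _ v => S.orderEmbOfFin rfl (g v)) ?_ ?_ ?_ ?_
    · intro g hg
      simp only [Finset.mem_filter, Finset.mem_univ, true_and] at hg ⊢
      ext s
      simp only [Finset.mem_image, Finset.mem_univ, true_and]
      constructor
      · rintro ⟨v, rfl⟩
        exact S.orderEmbOfFin_mem rfl _
      · intro hs
        have : s ∈ Set.range (S.orderEmbOfFin rfl) := by
          rw [Finset.range_orderEmbOfFin]; exact hs
        obtain ⟨i, rfl⟩ := this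
        obtain ⟨v, rfl⟩ := hg i
        exact ⟨v, rfl⟩
    · intro g₁ _ g₂ _ he
      funext v
      exact (S.orderEmbOfFin rfl).injective (congrFun he v)
    · intro f hf
      simp only [Finset.mem_filter, Finset.mem_univ, true_and] at hf
      have hr : ∀ v, ∃ i, S.orderEmbOfFin rfl i = f v := by
        intro v
        have : f v ∈ Set.range (S.orderEmbOfFin rfl) := by
          rw [Finset.range_orderEmbOfFin, ← hf]; simp
        exact this
      choose g hg using hr
      refine ⟨g, ?_, funext hg⟩
      simp only [Finset.mem_filter, Finset.mem_univ, true_and]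
      intro i
      have hi : S.orderEmbOfFin rfl i ∈ Finset.univ.image f := by
        rw [hf]; exact S.orderEmbOfFin_mem rfl i
      simp only [Finset.mem_image, Finset.mem_univ, true_and] at hi
      obtain ⟨v, hv⟩ := hi
      exact ⟨v, (S.orderEmbOfFin rfl).injective ((hg v).trans hv)⟩
    · intro g _
      have ha : D.numAscents (fun v => S.orderEmbOfFin rfl (g v)) = D.numAscents g := by
        simp [numAscents]
      have hd : D.numDescents (fun v => S.orderEmbOfFin rfl (g v)) = D.numDescents g := by
        simp [numDescents]
      rw [ha, hd]
  have h0 : ∀ p, Fintype.card V < p → h p = 0 := by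
    intro p hp
    refine Finset.sum_eq_zero fun g hg => ?_
    simp only [Finset.mem_filter, Finset.mem_univ, true_and] at hg
    have := Fintype.card_le_of_surjective g hg
    simp at this
    omega
  have e1 : ∑ f : V → Fin q, y ^ D.numAscents f * z ^ D.numDescents f =
      ∑ S : Finset (Fin q), h S.card := by
    rw [← Finset.sum_fiberwise (Finset.univ) (fun f : V → Fin q => Finset.univ.image f)]
    exact Finset.sum_congr rfl fun S _ => key S
  rw [e1, ← Finset.powerset_univ, Finset.sum_powerset_apply_card]
  simp only [Finset.card_univ, Fintype.card_fin]
  have e2 : ∀ a b : ℕ, (∀ p, b ≤ p → q.choose p • h p = 0) → b ≤ a →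
      ∑ p ∈ Finset.range a, q.choose p • h p = ∑ p ∈ Finset.range b, q.choose p • h p := by
    intro a b hb hab
    symm
    refine Finset.sum_subset (by simpa using hab) fun p _ hp => hb p (by simpa using hp)
  have hq : ∀ p, q + 1 ≤ p → q.choose p • h p = 0 := fun p hp => by
    rw [Nat.choose_eq_zero_of_lt (by omega), zero_smul]
  have hV : ∀ p, Fintype.card V + 1 ≤ p → q.choose p • h p = 0 := fun p hp => by
    rw [h0 p (by omega), smul_zero]
  rcases le_total (q + 1) (Fintype.card V + 1) with hle | hle
  · exact (e2 _ _ hq hle).symm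
  · exact e2 _ _ hV hle

open MvPolynomial in
open scoped Classical in
theorem exists_isBPolynomial [Fintype V] [Fintype A] (D : MultiDigraph V A) :
    ∃ B, D.IsBPolynomial B := by
  refine ⟨∑ p ∈ Finset.range (Fintype.card V + 1),
    C ((p.factorial : ℚ)⁻¹) * Polynomial.aeval (X 0) (descPochhammer ℚ p) *
      ∑ g : V → Fin p with Function.Surjective g,
        X 1 ^ D.numAscents g * X 2 ^ D.numDescents g, fun q _ => ?_⟩
  rw [sum_colorings, map_sum]
  refine Finset.sum_congr rfl fun p _ => ?_
  have hc : aeval ![(q : MvPolynomial (Fin 2) ℚ), X 0, X 1]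
      (Polynomial.aeval (X 0 : MvPolynomial (Fin 3) ℚ) (descPochhammer ℚ p)) =
      C ((q.descFactorial p : ℚ)) := by
    rw [← Polynomial.aeval_algHom_apply, aeval_X]
    have : (![(q : MvPolynomial (Fin 2) ℚ), X 0, X 1] 0) =
        algebraMap ℚ (MvPolynomial (Fin 2) ℚ) (q : ℚ) := by simp
    rw [this, Polynomial.aeval_algebraMap_apply, Polynomial.coe_aeval_eq_eval,
      descPochhammer_eval_eq_descFactorial]
    rfl
  rw [map_mul, map_mul, hc, aeval_C, MvPolynomial.algebraMap_eq, ← C_mul, nsmul_eq_mul]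
  have hn : (p.factorial : ℚ)⁻¹ * (q.descFactorial p : ℚ) = (q.choose p : ℚ) := by
    rw [Nat.descFactorial_eq_factorial_mul_choose]
    have : (p.factorial : ℚ) ≠ 0 := by exact_mod_cast p.factorial_ne_zero
    push_cast
    field_simp
  rw [hn]
  simp

theorem IsBPolynomial.unique [Fintype V] [Fintype A] {D : MultiDigraph V A}
    {B B' : MvPolynomial (Fin 3) ℚ} (h : D.IsBPolynomial B) (h' : D.IsBPolynomial B') :
    B = B' := by
  refine MvPolynomial.funext_set
    (fun i => if i = 0 then Set.range (fun n : ℕ => ((n : ℚ) + 1)) else Set.univ) ?_ ?_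
  · intro i
    split_ifs
    · exact Set.infinite_range_of_injective fun a b hab => by simpa using hab
    · exact Set.infinite_univ
  · intro x hx
    obtain ⟨n, hn⟩ : x 0 ∈ Set.range (fun n : ℕ => ((n : ℚ) + 1)) := by
      simpa using hx 0 (Set.mem_univ _)
    have e : ∀ P : MvPolynomial (Fin 3) ℚ, MvPolynomial.eval x P =
        MvPolynomial.aeval ![x 1, x 2] (MvPolynomial.aeval
          ![((n + 1 : ℕ) : MvPolynomial (Fin 2) ℚ), MvPolynomial.X 0, MvPolynomial.X 1] P) := by
      intro P
      rw [← AlgHom.comp_apply, MvPolynomial.comp_aeval, ← MvPolynomial.coe_aeval_eq_eval]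
      have hx' : x = fun i => MvPolynomial.aeval ![x 1, x 2]
          (![((n + 1 : ℕ) : MvPolynomial (Fin 2) ℚ), MvPolynomial.X 0, MvPolynomial.X 1] i) := by
        funext i
        fin_cases i <;> simp [← hn]
      exact congrArg (fun t => MvPolynomial.aeval t P) hx'
    rw [e, e, h _ n.succ_pos, h' _ n.succ_pos]

/-- The `B`-polynomial `B_D(q, y, z)`: the unique polynomial with `IsBPolynomial`. -/
noncomputable def bPolynomial [Fintype V] [Fintype A] (D : MultiDigraph V A) :
    MvPolynomial (Fin 3) ℚ :=
  D.exists_isBPolynomial.choose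

open scoped Classical in
/-- The arc sets `S` such that `D ∖ S` is acyclic. -/
noncomputable def acyclicDeletions [Fintype A] (D : MultiDigraph V A) : Finset (Finset A) :=
  Finset.univ.filter fun S => (D.delete S).IsAcyclic

end MultiDigraph

/-- A mixed graph: a digraph with a partition of its arc set into singletons (the oriented edges)
and doubletons made of two opposite arcs (the unoriented edges). -/
structure MixedGraph (V A : Type*) [Fintype A] [DecidableEq A] extends MultiDigraph V A where
  edges : Finpartition (Finset.univ : Finset A)
  edges_spec : ∀ e ∈ edges.parts,
    (∃ a, e = {a}) ∨ ∃ a b, a ≠ b ∧ toMultiDigraph.IsOpposite a b ∧ e = {a, b}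

namespace MixedGraph

variable {V A : Type*} [Fintype V] [Fintype A] [DecidableEq A]

/-- The number `|E(D)|` of edges (oriented or not) of a mixed graph. -/
def numEdges (D : MixedGraph V A) : ℕ := D.edges.parts.card

/-- The invariant
`T⁽¹⁾_D(x, y) = y ^ |E(D)| / ((y - 1) ^ |V| (x - 1) ^ c(D)) * B_D((x - 1)(y - 1), 1 / y, 1)`,
as a rational function in `x` (variable `0`) and `y` (variable `1`). -/
noncomputable def tutteOne (D : MixedGraph V A) : FractionRing (MvPolynomial (Fin 2) ℚ) :=
  let x := algebraMap (MvPolynomial (Fin 2) ℚ) (FractionRing (MvPolynomial (Fin 2) ℚ))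
    (MvPolynomial.X 0)
  let y := algebraMap (MvPolynomial (Fin 2) ℚ) (FractionRing (MvPolynomial (Fin 2) ℚ))
    (MvPolynomial.X 1)
  y ^ D.numEdges / ((y - 1) ^ Fintype.card V * (x - 1) ^ D.numComponents) *
    MvPolynomial.aeval ![(x - 1) * (y - 1), 1 / y, 1] D.bPolynomial

end MixedGraph

/-! The exponent of `y` in `y ^ |E| * B_D(q, 1 / y, 1)` counts the edges on which a coloring has no
ascent. Expanding `y = 1 + (y - 1)` on each such edge gives a sum over sets `S` of edges of
`(y - 1) ^ |S|` times the weak order polynomial of the arcs of `S`, which is divisible by `q ^ k`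
for `k` the number of components of `(V, S)`. Since `k ≥ c(D)` and `k + |S| ≥ |V|`, setting
`q = (x - 1) * (y - 1)` shows that the denominator of `T⁽¹⁾_D` divides the numerator.

At `(y + 2, y / (y + 1))` one has `q = -1`. After multiplication by `(y + 1) ^ |E|`, each ascent
of a coloring carries `y + 1`, and expanding these factors gives a sum over sets `S` of arcs of
`y ^ (|E| - |A ∖ S|)` times the strict order polynomial of `D ∖ S`. This polynomial vanishes unless
`D ∖ S` is acyclic, and then its value at `-1` is `(-1) ^ |V|`: a strict coloring with `q + 1`
colors amounts to a set `I` of minimal vertices (the color class of `0`) and a strict coloring of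
`V ∖ I` with `q` colors, and induction on `|V|` applies to this recurrence at `q = -1`. -/

theorem polynomial_eq_of_eval_natCast {R : Type*} [CommRing R] [IsDomain R] [CharZero R]
    {P Q : Polynomial R} (h : ∀ n : ℕ, P.eval (n : R) = Q.eval (n : R)) : P = Q :=
  Polynomial.eq_of_infinite_eval_eq P Q <|
    (Set.infinite_range_of_injective Nat.cast_injective).mono (Set.range_subset_iff.2 h)

theorem map_aeval_rat {R R' : Type*} [CommRing R] [CommRing R'] [Algebra ℚ R] [Algebra ℚ R']
    (φ : R →+* R') (q : R) (P : Polynomial ℚ) :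
    φ (Polynomial.aeval q P) = Polynomial.aeval (φ q) P :=
  (Polynomial.aeval_algHom_apply φ.toRatAlgHom q P).symm

namespace MultiDigraph

variable {V A : Type*} [Fintype A]

theorem numAscents_eq_zero_iff (D : MultiDigraph V A) {q : ℕ} {f : V → Fin q} :
    D.numAscents f = 0 ↔ ∀ a, f (D.target a) ≤ f (D.origin a) := by
  simp [numAscents, Finset.filter_eq_empty_iff]

theorem numAscents_eq_card_iff (D : MultiDigraph V A) {q : ℕ} {f : V → Fin q} :
    D.numAscents f = Fintype.card A ↔ ∀ a, f (D.origin a) < f (D.target a) := by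
  simp [numAscents, ← Finset.card_univ, Finset.card_filter_eq_iff]

variable [Fintype V] {R : Type*} [CommRing R] [Algebra ℚ R]

-- `IsBPolynomial` only speaks of `q > 0`; `q = 0` is what makes order polynomials divisible by `X`.
open scoped Classical in
theorem exists_aeval_natCast_eq_sum (D : MultiDigraph V A) :
    ∃ B : MvPolynomial (Fin 3) ℚ, ∀ q : ℕ,
      MvPolynomial.aeval ![(q : MvPolynomial (Fin 2) ℚ), MvPolynomial.X 0, MvPolynomial.X 1] B =
        ∑ f : V → Fin q,
          MvPolynomial.X 0 ^ D.numAscents f * MvPolynomial.X 1 ^ D.numDescents f := by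
  refine ⟨∑ p ∈ Finset.range (Fintype.card V + 1), Ring.choose (MvPolynomial.X 0) p *
    ∑ g : V → Fin p with Function.Surjective g,
      MvPolynomial.X 1 ^ D.numAscents g * MvPolynomial.X 2 ^ D.numDescents g, fun q => ?_⟩
  simp [sum_colorings, Ring.map_choose, Ring.choose_natCast]

open scoped Classical in
theorem aeval_bPolynomial_natCast (D : MultiDigraph V A) (q : ℕ) (y z : R) :
    MvPolynomial.aeval ![(q : R), y, z] D.bPolynomial =
      ∑ f : V → Fin q, y ^ D.numAscents f * z ^ D.numDescents f := by
  obtain ⟨B, hB⟩ := D.exists_aeval_natCast_eq_sum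
  have hD : D.bPolynomial = B := D.exists_isBPolynomial.choose_spec.unique fun q _ => hB q
  have h := congrArg (MvPolynomial.aeval ![y, z]) (hB q)
  rw [← AlgHom.comp_apply, MvPolynomial.comp_aeval] at h
  have hvec : (fun i => MvPolynomial.aeval ![y, z]
      (![(q : MvPolynomial (Fin 2) ℚ), MvPolynomial.X 0, MvPolynomial.X 1] i)) =
      ![(q : R), y, z] := by
    funext i; fin_cases i <;> simp
  simpa [hD, hvec] using h

/-- The polynomial whose value at `q` is the number of colorings `V → Fin q` with exactly `k`
ascents: the coefficient of `y ^ k` in `B_D(q, y, 1)`. -/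
noncomputable def ascentPoly (D : MultiDigraph V A) (k : ℕ) : Polynomial ℚ :=
  (MvPolynomial.aeval ![Polynomial.C Polynomial.X, Polynomial.X, 1] D.bPolynomial :
    Polynomial (Polynomial ℚ)).coeff k

theorem aeval_natCast_ascentPoly (D : MultiDigraph V A) (k q : ℕ) :
    Polynomial.aeval (q : R) (D.ascentPoly k) = Nat.card {f : V → Fin q // D.numAscents f = k} := by
  classical
  let φ : Polynomial (Polynomial ℚ) →ₐ[ℚ] Polynomial R :=
    Polynomial.mapAlgHom (Polynomial.aeval (q : R))
  have hvec : (fun i => φ (![Polynomial.C Polynomial.X, Polynomial.X, 1] i)) =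
      ![(q : Polynomial R), Polynomial.X, 1] := by
    funext i; fin_cases i <;> simp [φ]
  have h : φ (MvPolynomial.aeval ![Polynomial.C Polynomial.X, Polynomial.X, 1] D.bPolynomial) =
      ∑ f : V → Fin q, Polynomial.X ^ D.numAscents f := by
    rw [← AlgHom.comp_apply, MvPolynomial.comp_aeval, hvec, aeval_bPolynomial_natCast]
    simp only [one_pow, mul_one]
  calc Polynomial.aeval (q : R) (D.ascentPoly k)
      = (φ (MvPolynomial.aeval ![Polynomial.C Polynomial.X, Polynomial.X, 1]
          D.bPolynomial)).coeff k := by simp [φ, ascentPoly]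
    _ = Nat.card {f : V → Fin q // D.numAscents f = k} := by
      simp [h, Polynomial.coeff_X_pow, Nat.card_eq_fintype_card, Fintype.card_subtype, eq_comm]

end MultiDigraph

section OrderPolynomials

open Polynomial

variable {V : Type*} [Fintype V] {R : Type*} [CommRing R] [Algebra ℚ R] (r : V → V → Prop)

/-- The digraph with one arc from `u` to `v` for every pair with `r u v`. -/
def MultiDigraph.ofRel {V : Type*} (r : V → V → Prop) :
    MultiDigraph V {e : V × V // r e.1 e.2} where
  origin e := e.1.1
  target e := e.1.2

open scoped Classical in
/-- The weak order polynomial of `r`: its value at `q` is the number of maps `f : V → Fin q` with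
`f v ≤ f u` whenever `r u v`. These are the colorings of `MultiDigraph.ofRel r` with no ascent. -/
noncomputable def weakOrderPoly : ℚ[X] :=
  (MultiDigraph.ofRel r).ascentPoly 0

open scoped Classical in
/-- The strict order polynomial of `r`: its value at `q` is the number of maps `f : V → Fin q` with
`f u < f v` whenever `r u v`. These are the colorings of `MultiDigraph.ofRel r` for which every arc
is an ascent. -/
noncomputable def strictOrderPoly : ℚ[X] :=
  (MultiDigraph.ofRel r).ascentPoly (Fintype.card {e : V × V // r e.1 e.2})

theorem aeval_natCast_weakOrderPoly (q : ℕ) :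
    aeval (q : R) (weakOrderPoly r) = Nat.card {f : V → Fin q // ∀ u v, r u v → f v ≤ f u} := by
  classical
  rw [weakOrderPoly, MultiDigraph.aeval_natCast_ascentPoly]
  simp only [MultiDigraph.numAscents_eq_zero_iff, Subtype.forall, Prod.forall, MultiDigraph.ofRel]

theorem aeval_natCast_strictOrderPoly (q : ℕ) :
    aeval (q : R) (strictOrderPoly r) =
      Nat.card {f : V → Fin q // ∀ u v, r u v → f u < f v} := by
  classical
  rw [strictOrderPoly, MultiDigraph.aeval_natCast_ascentPoly]
  simp only [MultiDigraph.numAscents_eq_card_iff, Subtype.forall, Prod.forall, MultiDigraph.ofRel]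

theorem weakOrderPoly_eq_prod {ι : Type*} [Fintype ι] [DecidableEq ι] {π : V → ι}
    (hπ : ∀ u v, r u v → π u = π v) :
    weakOrderPoly r = ∏ i, weakOrderPoly fun u v : {v // π v = i} => r u v := by
  refine polynomial_eq_of_eval_natCast fun q => ?_
  simp only [eval_prod, ← coe_aeval_eq_eval, aeval_natCast_weakOrderPoly]
  rw [← Nat.cast_prod, ← Nat.card_pi, Nat.cast_inj]
  refine Nat.card_congr
    { toFun := fun f i => ⟨fun v => f.1 v, fun u v h => f.2 u v h⟩
      invFun := fun F => ⟨fun v => (F (π v)).1 ⟨v, rfl⟩, fun u v h => ?_⟩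
      left_inv := fun f => rfl
      right_inv := fun F => ?_ }
  · have hF : ∀ i (hi : π u = i), (F (π u)).1 ⟨u, rfl⟩ = (F i).1 ⟨u, hi⟩ := by
      rintro _ rfl; rfl
    beta_reduce
    rw [hF _ (hπ u v h)]
    exact (F (π v)).2 ⟨u, hπ u v h⟩ ⟨v, rfl⟩ h
  · funext i
    ext ⟨v, rfl⟩
    rfl

theorem X_dvd_weakOrderPoly [Nonempty V] : X ∣ weakOrderPoly r := by
  have h0 := aeval_natCast_weakOrderPoly (R := ℚ) r 0
  rw [X_dvd_iff, coeff_zero_eq_eval_zero, ← coe_aeval_eq_eval]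
  simpa using h0

theorem X_pow_card_dvd_weakOrderPoly {ι : Type*} [Fintype ι] {π : V → ι}
    (hsurj : Function.Surjective π) (hπ : ∀ u v, r u v → π u = π v) :
    X ^ Fintype.card ι ∣ weakOrderPoly r := by
  classical
  rw [weakOrderPoly_eq_prod r hπ, Fintype.card, ← Finset.prod_const]
  refine Finset.prod_dvd_prod_of_dvd _ _ fun i _ => ?_
  obtain ⟨v, hv⟩ := hsurj i
  have : Nonempty {v // π v = i} := ⟨⟨v, hv⟩⟩
  exact X_dvd_weakOrderPoly _

theorem X_pow_card_connectedComponent_dvd_weakOrderPoly :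
    X ^ Nat.card (SimpleGraph.fromRel r).ConnectedComponent ∣ weakOrderPoly r := by
  classical
  rw [Nat.card_eq_fintype_card]
  refine X_pow_card_dvd_weakOrderPoly r Quot.mk_surjective fun u v h => ?_
  rcases eq_or_ne u v with rfl | huv
  · rfl
  · exact SimpleGraph.ConnectedComponent.sound
      (SimpleGraph.Adj.reachable ((SimpleGraph.fromRel_adj r u v).2 ⟨huv, .inl h⟩))

variable {r}

theorem strictOrderPoly_congr {W : Type*} [Fintype W] {s : W → W → Prop} (e : r ≃r s) :
    strictOrderPoly r = strictOrderPoly s := by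
  refine polynomial_eq_of_eval_natCast fun q => ?_
  simp only [← coe_aeval_eq_eval, aeval_natCast_strictOrderPoly, Nat.cast_inj]
  have hsymm (v : V) : e.toEquiv.symm (e v) = v := e.toEquiv.symm_apply_apply v
  refine Nat.card_congr ((e.toEquiv.arrowCongr (Equiv.refl _)).subtypeEquiv fun f => ?_)
  simp [e.surjective.forall, e.map_rel_iff, hsymm]

theorem strictOrderPoly_of_isEmpty [IsEmpty V] : strictOrderPoly r = 1 := by
  refine polynomial_eq_of_eval_natCast fun q => ?_
  rw [← coe_aeval_eq_eval, aeval_natCast_strictOrderPoly]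
  simp

theorem aeval_zero_strictOrderPoly [Nonempty V] : aeval (0 : R) (strictOrderPoly r) = 0 := by
  simpa using aeval_natCast_strictOrderPoly (R := R) r 0

theorem forall_not_transGen_of_strict {V α : Type*} [Preorder α] {r : V → V → Prop} {f : V → α}
    (hf : ∀ u v, r u v → f u < f v) (v : V) : ¬ Relation.TransGen r v v := fun hv =>
  lt_irrefl (f v) (by simpa only [Relation.transGen_eq_self] using hv.lift f hf)

theorem strictOrderPoly_eq_zero (h : ∀ (q : ℕ) (f : V → Fin q), ¬ ∀ u v, r u v → f u < f v) :
    strictOrderPoly r = 0 := by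
  refine polynomial_eq_of_eval_natCast fun q => ?_
  have : IsEmpty {f : V → Fin q // ∀ u v, r u v → f u < f v} := ⟨fun f => h q f.1 f.2⟩
  rw [← coe_aeval_eq_eval, aeval_natCast_strictOrderPoly, Nat.card_of_isEmpty]
  simp

/-- The strictly increasing maps to `Fin (q + 1)` whose fiber over `0` is a given set `I` of minimal
elements are the strictly increasing maps to `Fin q` on the complement of `I`. -/
def strictMapsFiberZeroEquiv [DecidableEq V] (q : ℕ) {I : Finset V} (hI : ∀ v ∈ I, ∀ u, ¬ r u v) :
    {f : V → Fin (q + 1) // (∀ u v, r u v → f u < f v) ∧ ∀ v, f v = 0 ↔ v ∈ I} ≃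
      {g : {v // v ∉ I} → Fin q // ∀ u v : {v // v ∉ I}, r u v → g u < g v} where
  toFun f := ⟨fun v => (f.1 v).pred fun h => v.2 ((f.2.2 v).1 h),
    fun u v h => by simpa using f.2.1 u v h⟩
  invFun g := ⟨fun v => if h : v ∈ I then 0 else (g.1 ⟨v, h⟩).succ, fun u v huv => by
    have hv : v ∉ I := fun hv => hI v hv u huv
    by_cases hu : u ∈ I
    · simp [hu, hv, Fin.succ_pos]
    · simpa [hu, hv] using g.2 ⟨u, hu⟩ ⟨v, hv⟩ huv,
    fun v => by by_cases hv : v ∈ I <;> simp [hv, Fin.succ_ne_zero]⟩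
  left_inv f := by
    ext v : 2
    by_cases hv : v ∈ I <;> simp [hv, (f.2.2 v).2]
  right_inv g := by ext v; simp [v.2]

open scoped Classical in
theorem card_strictMaps_succ (q : ℕ) :
    Nat.card {f : V → Fin (q + 1) // ∀ u v, r u v → f u < f v} =
      ∑ I ∈ (Finset.univ.filter fun v => ∀ u, ¬ r u v).powerset,
        Nat.card {g : {v // v ∉ I} → Fin q // ∀ u v : {v // v ∉ I}, r u v → g u < g v} := by
  have hfiber : ∀ f ∈ Finset.univ.filter fun f : V → Fin (q + 1) => ∀ u v, r u v → f u < f v,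
      Finset.univ.filter (f · = 0) ∈ (Finset.univ.filter fun v => ∀ u, ¬ r u v).powerset := by
    intro f hf
    simp only [Finset.mem_powerset, Finset.subset_iff, Finset.mem_filter, Finset.mem_univ,
      true_and] at hf ⊢
    exact fun v hv u huv => Fin.not_lt_zero (f u) (hv ▸ hf u v huv)
  rw [Nat.card_eq_fintype_card, Fintype.card_subtype, Finset.card_eq_sum_card_fiberwise hfiber]
  refine Finset.sum_congr rfl fun I hI => ?_
  have hmin : ∀ v ∈ I, ∀ u, ¬ r u v := fun v hv => by
    simpa using Finset.mem_powerset.1 hI hv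
  rw [← Nat.card_congr (strictMapsFiberZeroEquiv q hmin), Nat.card_eq_fintype_card,
    Fintype.card_subtype, Finset.filter_filter]
  simp [Finset.ext_iff]

open scoped Classical in
theorem strictOrderPoly_comp_X_add_one :
    (strictOrderPoly r).comp (X + 1) =
      ∑ I ∈ (Finset.univ.filter fun v => ∀ u, ¬ r u v).powerset,
        strictOrderPoly fun u v : {v // v ∉ I} => r u v := by
  refine polynomial_eq_of_eval_natCast fun q => ?_
  have hq : (q : ℚ) + 1 = ((q + 1 : ℕ) : ℚ) := by norm_cast
  simp only [eval_comp, eval_add, eval_X, eval_one, eval_finsetSum, hq, ← coe_aeval_eq_eval,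
    aeval_natCast_strictOrderPoly, card_strictMaps_succ, Nat.cast_sum]

theorem exists_minimal_of_acyclic {V : Type*} [Finite V] [Nonempty V] {r : V → V → Prop}
    (hr : ∀ v, ¬ Relation.TransGen r v v) : ∃ v, ∀ u, ¬ r u v := by
  have : Std.Irrefl (Relation.TransGen r) := ⟨hr⟩
  have hwf : WellFounded (Relation.TransGen r) := Finite.wellFounded_of_trans_of_irrefl _
  obtain ⟨v, -, hv⟩ := hwf.has_min Set.univ Set.univ_nonempty
  exact ⟨v, fun u h => hv u trivial (.single h)⟩

theorem aeval_neg_one_strictOrderPoly (hr : ∀ v, ¬ Relation.TransGen r v v) :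
    aeval (-1 : R) (strictOrderPoly r) = (-1) ^ Fintype.card V := by
  classical
  induction hn : Fintype.card V using Nat.strong_induction_on generalizing V with
  | _ n ih =>
  rcases isEmpty_or_nonempty V with hV | hV
  · simp [strictOrderPoly_of_isEmpty, ← hn]
  set M : Finset V := Finset.univ.filter fun v => ∀ u, ¬ r u v with hM
  have hM_nonempty : M.Nonempty := by
    simpa [hM, Finset.filter_nonempty_iff] using exists_minimal_of_acyclic hr
  have hrec : 0 = ∑ I ∈ M.powerset,
      aeval (-1 : R) (strictOrderPoly fun u v : {v // v ∉ I} => r u v) := by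
    simpa [aeval_comp, aeval_zero_strictOrderPoly] using
      congrArg (aeval (-1 : R)) (strictOrderPoly_comp_X_add_one (r := r))
  have hsigns : ∑ I ∈ M.powerset, (-1 : R) ^ I.card = 0 := by
    exact_mod_cast congrArg (Int.cast : ℤ → R)
      (Finset.sum_powerset_neg_one_pow_card_of_nonempty hM_nonempty)
  have hempty : (strictOrderPoly fun u v : {v // v ∉ (∅ : Finset V)} => r u v) =
      strictOrderPoly r :=
    strictOrderPoly_congr ⟨Equiv.subtypeUnivEquiv (Finset.notMem_empty), Iff.rfl⟩
  have hproper : ∀ I ∈ M.powerset.erase ∅,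
      aeval (-1 : R) (strictOrderPoly fun u v : {v // v ∉ I} => r u v) =
        (-1) ^ n * (-1) ^ I.card := by
    intro I hI
    have hpos : 0 < I.card := Finset.card_pos.2 (Finset.nonempty_iff_ne_empty.2
      (Finset.mem_erase.1 hI).1)
    have hle : I.card ≤ n := hn ▸ Finset.card_le_univ I
    have hcard : Fintype.card {v // v ∉ I} = n - I.card := by simp [Fintype.card_subtype_compl, hn]
    have hacyclic : ∀ v : {v // v ∉ I},
        ¬ Relation.TransGen (fun u v : {v // v ∉ I} => r u v) v v := fun v hv =>
      hr v (hv.lift Subtype.val fun _ _ h => h)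
    rw [ih (n - I.card) (by lia) hacyclic hcard, ← pow_add]
    exact neg_one_pow_congr (by grind)
  rw [← Finset.add_sum_erase _ _ (Finset.empty_mem_powerset M)] at hrec hsigns
  rw [hempty, Finset.sum_congr rfl hproper, ← Finset.mul_sum] at hrec
  simp only [Finset.card_empty, pow_zero] at hsigns
  linear_combination -(-1) ^ n * hsigns - hrec

theorem exists_strictMap_of_acyclic {V : Type*} [Finite V] {r : V → V → Prop}
    (hr : ∀ v, ¬ Relation.TransGen r v v) :
    ∃ (q : ℕ) (f : V → Fin q), ∀ u v, r u v → f u < f v := by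
  have := Fintype.ofFinite V
  by_contra! hnone
  have hzero : strictOrderPoly r = 0 := strictOrderPoly_eq_zero fun q f hf =>
    let ⟨u, v, huv, hle⟩ := hnone q f; hle.not_gt (hf u v huv)
  have hvalue := aeval_neg_one_strictOrderPoly (R := ℚ) hr
  rw [hzero, map_zero] at hvalue
  exact pow_ne_zero _ (by norm_num) hvalue.symm

end OrderPolynomials

theorem card_vert_le_card_add_card_connectedComponent {V ι : Type*} [Fintype V] [Fintype ι]
    (G : SimpleGraph V) (s t : ι → V)
    (h : ∀ u v, G.Adj u v → ∃ i, s i = u ∧ t i = v ∨ s i = v ∧ t i = u) :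
    Fintype.card V ≤ Fintype.card ι + Nat.card G.ConnectedComponent := by
  classical
  let φ : (V → ℝ) →ₗ[ℝ] (ι → ℝ) := LinearMap.funLeft ℝ ℝ s - LinearMap.funLeft ℝ ℝ t
  have hker : φ.ker ≤ (G.lapMatrix ℝ).toLin'.ker := by
    intro x hx
    have hxi (i : ι) : x (s i) = x (t i) := by
      simpa [φ, LinearMap.funLeft_apply, sub_eq_zero] using congrFun (LinearMap.mem_ker.1 hx) i
    rw [LinearMap.mem_ker, Matrix.toLin'_apply, G.lapMatrix_mulVec_eq_zero_iff_forall_adj]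
    intro u v huv
    obtain ⟨i, ⟨rfl, rfl⟩ | ⟨rfl, rfl⟩⟩ := h u v huv
    exacts [hxi i, (hxi i).symm]
  have hrank := φ.finrank_range_add_finrank_ker
  have hrange := Submodule.finrank_le φ.range
  have hcomponents := Submodule.finrank_mono hker
  rw [← G.card_connectedComponent_eq_finrank_ker_toLin'_lapMatrix, ← Nat.card_eq_fintype_card]
    at hcomponents
  simp only [Module.finrank_fintype_fun_eq_card] at hrank hrange
  lia

namespace MultiDigraph

variable {V A : Type*} [Fintype A] [DecidableEq A]

theorem strict_delete_iff (D : MultiDigraph V A) {S : Finset A} {q : ℕ} {f : V → Fin q} :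
    (∀ u v, (D.delete S).HasArc u v → f u < f v) ↔
      Sᶜ ⊆ Finset.univ.filter fun a => f (D.origin a) < f (D.target a) := by
  simp only [HasArc, delete, Subtype.exists, Finset.subset_iff, Finset.mem_compl,
    Finset.mem_filter_univ]
  exact ⟨fun h a ha => h _ _ ⟨a, ha, rfl, rfl⟩, fun h _ _ ⟨a, ha, hu, hv⟩ => hu ▸ hv ▸ h ha⟩

end MultiDigraph

namespace MixedGraph

section Edges

variable {V A : Type*} [Fintype A] [DecidableEq A] (D : MixedGraph V A)

/-- The relation on the vertices given by the arcs of the edges in `S`. -/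
def arcRel (S : Finset (Finset A)) (u v : V) : Prop :=
  ∃ e ∈ S, ∃ a ∈ e, D.origin a = u ∧ D.target a = v

/-- The edges none of whose arcs is an ascent of the coloring `f`. -/
def nonAscentEdges {q : ℕ} (f : V → Fin q) : Finset (Finset A) :=
  D.edges.parts.filter fun e => ∀ a ∈ e, f (D.target a) ≤ f (D.origin a)

theorem card_nonAscentEdges_add_numAscents {q : ℕ} (f : V → Fin q) :
    (D.nonAscentEdges f).card + D.numAscents f = D.numEdges := by
  have hasc : D.numAscents f =
      ∑ e ∈ D.edges.parts, ∑ a ∈ e, if f (D.origin a) < f (D.target a) then 1 else 0 := by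
    rw [MultiDigraph.numAscents, Finset.card_filter,
      ← Finset.sum_congr D.edges.biUnion_parts fun _ _ => rfl, Finset.sum_biUnion D.edges.disjoint]
    rfl
  rw [hasc, nonAscentEdges, Finset.card_filter, ← Finset.sum_add_distrib, numEdges,
    Finset.card_eq_sum_ones]
  refine Finset.sum_congr rfl fun e he => ?_
  obtain ⟨a, rfl⟩ | ⟨a, b, hab, ⟨hab', hba'⟩, rfl⟩ := D.edges_spec e he
  · by_cases h : f (D.origin a) < f (D.target a)
    · simp [h, h.not_ge, Finset.sum_singleton, -Finset.sum_boole]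
    · simp [h, not_lt.1 h, -Finset.sum_boole]
  · rw [Finset.sum_pair hab]
    simp only [Finset.mem_insert, Finset.mem_singleton, forall_eq_or_imp, forall_eq, hab', hba']
    rcases lt_trichotomy (f (D.target b)) (f (D.origin b)) with h | h | h
    · simp [h, h.not_ge, h.not_gt]
    · simp [h]
    · simp [h, h.not_ge, h.not_gt]

theorem subset_nonAscentEdges_iff {q : ℕ} {f : V → Fin q} {S : Finset (Finset A)}
    (hS : S ⊆ D.edges.parts) :
    S ⊆ D.nonAscentEdges f ↔ ∀ u v, D.arcRel S u v → f v ≤ f u := by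
  constructor
  · rintro h _ _ ⟨e, he, a, ha, rfl, rfl⟩
    exact (Finset.mem_filter.1 (h he)).2 a ha
  · exact fun h e he => Finset.mem_filter.2 ⟨hS he, fun a ha => h _ _ ⟨e, he, a, ha, rfl, rfl⟩⟩

theorem card_compl_le_numEdges [Finite V] {S : Finset A} (hS : (D.delete S).IsAcyclic) :
    Sᶜ.card ≤ D.numEdges := by
  obtain ⟨q, f, hf⟩ := exists_strictMap_of_acyclic hS
  calc Sᶜ.card ≤ D.numAscents f := Finset.card_le_card (D.strict_delete_iff.1 hf)
    _ ≤ D.numEdges := by simp [← D.card_nonAscentEdges_add_numAscents f]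

theorem pow_mul_pow_numAscents_eq_sum {R : Type*} [CommSemiring R] {q : ℕ} (f : V → Fin q)
    (y : R) :
    y ^ (D.nonAscentEdges f).card * (y + 1) ^ D.numAscents f =
      ∑ S : Finset A, if Sᶜ ⊆ Finset.univ.filter fun a => f (D.origin a) < f (D.target a) then
        y ^ (D.numEdges - Sᶜ.card) else 0 := by
  set ascents : Finset A := Finset.univ.filter fun a => f (D.origin a) < f (D.target a)
  have hedges : (D.nonAscentEdges f).card + ascents.card = D.numEdges :=
    D.card_nonAscentEdges_add_numAscents f
  calc y ^ (D.nonAscentEdges f).card * (y + 1) ^ ascents.card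
      = ∑ S ∈ ascents.powerset, y ^ (D.numEdges - S.card) := by
        rw [add_comm y, ← Finset.sum_pow_mul_eq_add_pow, Finset.mul_sum]
        refine Finset.sum_congr rfl fun S hS => ?_
        have hle := Finset.card_le_card (Finset.mem_powerset.1 hS)
        rw [one_pow, one_mul, ← pow_add, ← hedges, Nat.add_sub_assoc hle]
    _ = ∑ S : Finset A, if S ⊆ ascents then y ^ (D.numEdges - S.card) else 0 := by
        rw [← Finset.sum_filter]
        exact Finset.sum_congr (by ext; simp) fun _ _ => rfl
    _ = ∑ S : Finset A, if Sᶜ ⊆ ascents then y ^ (D.numEdges - Sᶜ.card) else 0 :=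
        (Fintype.sum_bijective compl compl_bijective _ _ fun _ => rfl).symm

theorem eq_or_isOpposite_of_mem {e : Finset A} (he : e ∈ D.edges.parts) {a b : A} (ha : a ∈ e)
    (hb : b ∈ e) :
    D.origin a = D.origin b ∧ D.target a = D.target b ∨ D.IsOpposite a b := by
  obtain ⟨c, rfl⟩ | ⟨c, d, -, ⟨hcd, hdc⟩, rfl⟩ := D.edges_spec e he
  · simp_all
  · simp only [Finset.mem_insert, Finset.mem_singleton] at ha hb
    rcases ha with rfl | rfl <;> rcases hb with rfl | rfl <;>
      simp [MultiDigraph.IsOpposite, hcd, hdc]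

theorem card_vert_le_card_add_card_connectedComponent_arcRel [Fintype V]
    {S : Finset (Finset A)} (hS : S ⊆ D.edges.parts) :
    Fintype.card V ≤
      S.card + Nat.card (SimpleGraph.fromRel (D.arcRel S)).ConnectedComponent := by
  choose a ha using fun e : S => D.edges.nonempty_of_mem_parts (hS e.2)
  have hcover : ∀ u v, D.arcRel S u v → ∃ e, D.origin (a e) = u ∧ D.target (a e) = v ∨
      D.origin (a e) = v ∧ D.target (a e) = u := by
    rintro _ _ ⟨e, he, b, hb, rfl, rfl⟩
    exact ⟨⟨e, he⟩, D.eq_or_isOpposite_of_mem (hS he) (ha ⟨e, he⟩) hb⟩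
  have h := card_vert_le_card_add_card_connectedComponent (SimpleGraph.fromRel (D.arcRel S))
    (fun e => D.origin (a e)) (fun e => D.target (a e)) fun u v huv => by
      rcases ((SimpleGraph.fromRel_adj _ _ _).1 huv).2 with h | h
      · exact hcover u v h
      · exact (hcover v u h).imp fun _ => Or.symm
  simpa using h

theorem numComponents_le_card_connectedComponent_arcRel [Finite V] (S : Finset (Finset A)) :
    D.numComponents ≤ Nat.card (SimpleGraph.fromRel (D.arcRel S)).ConnectedComponent := by
  have hrel : ∀ u v, D.arcRel S u v → D.HasArc u v := fun u v ⟨_, _, a, _, h⟩ => ⟨a, h⟩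
  refine SimpleGraph.ConnectedComponent.card_le_card_of_le fun u v h => ?_
  rw [SimpleGraph.fromRel_adj] at h ⊢
  exact ⟨h.1, h.2.imp (hrel _ _) (hrel _ _)⟩

end Edges

section EdgeExpansion

variable {V A : Type*} [Fintype V] [Fintype A] [DecidableEq A] (D : MixedGraph V A)

/-- The expansion of `y ^ |E| * B_D(q, 1 / y, 1)` obtained by writing
`y ^ |nonAscentEdges f| = ∑ S, (y - 1) ^ |S|` over the subsets `S` and exchanging the sums. It is
polynomial in `y` and shows the order of vanishing at `q = 0` and at `y = 1`. -/
noncomputable def edgeExpansion {R : Type*} [CommRing R] [Algebra ℚ R] (q y : R) : R :=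
  ∑ S ∈ D.edges.parts.powerset,
    (y - 1) ^ S.card * Polynomial.aeval q (weakOrderPoly (D.arcRel S))

section CommRing

variable {R : Type*} [CommRing R] [Algebra ℚ R]

theorem map_edgeExpansion {R' : Type*} [CommRing R'] [Algebra ℚ R'] (φ : R →+* R') (q y : R) :
    φ (D.edgeExpansion q y) = D.edgeExpansion (φ q) (φ y) := by
  simp [edgeExpansion, map_aeval_rat]

theorem eval_edgeExpansion_X_C (q y : R) :
    (D.edgeExpansion Polynomial.X (Polynomial.C y)).eval q = D.edgeExpansion q y := by
  simpa using D.map_edgeExpansion (Polynomial.evalRingHom q) Polynomial.X (Polynomial.C y)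

open scoped Classical in
theorem edgeExpansion_natCast (q : ℕ) (y : R) :
    D.edgeExpansion (q : R) y = ∑ f : V → Fin q, y ^ (D.nonAscentEdges f).card := by
  classical
  have hcard : ∀ S ∈ D.edges.parts.powerset,
      (Nat.card {f : V → Fin q // ∀ u v, D.arcRel S u v → f v ≤ f u} : R) =
        ∑ f : V → Fin q, if S ⊆ D.nonAscentEdges f then 1 else 0 := fun S hS => by
    simp only [← D.subset_nonAscentEdges_iff (Finset.mem_powerset.1 hS), Nat.card_eq_fintype_card,
      Fintype.card_subtype, Finset.sum_boole]
  have hpow (f : V → Fin q) : ∑ S ∈ D.edges.parts.powerset,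
      (if S ⊆ D.nonAscentEdges f then (y - 1) ^ S.card else 0) =
        y ^ (D.nonAscentEdges f).card := by
    have hfilter : D.edges.parts.powerset.filter (· ⊆ D.nonAscentEdges f) =
        (D.nonAscentEdges f).powerset := by
      ext S
      simpa using fun h => h.trans (Finset.filter_subset _ _)
    simpa [← Finset.sum_filter, hfilter] using
      Finset.sum_pow_mul_eq_add_pow (y - 1) 1 (D.nonAscentEdges f)
  simp only [← hpow]
  rw [edgeExpansion, Finset.sum_comm (s := Finset.univ)]
  refine Finset.sum_congr rfl fun S hS => ?_
  rw [aeval_natCast_weakOrderPoly, hcard S hS, Finset.mul_sum]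
  simp only [mul_ite, mul_one, mul_zero]

theorem pow_mul_pow_dvd_edgeExpansion (x y : R) :
    (y - 1) ^ Fintype.card V * (x - 1) ^ D.numComponents ∣
      D.edgeExpansion ((x - 1) * (y - 1)) y := by
  refine Finset.dvd_sum fun S hS => ?_
  set k := Nat.card (SimpleGraph.fromRel (D.arcRel S)).ConnectedComponent
  have hvert : Fintype.card V ≤ S.card + k :=
    D.card_vert_le_card_add_card_connectedComponent_arcRel (Finset.mem_powerset.1 hS)
  have hcomp : D.numComponents ≤ k := D.numComponents_le_card_connectedComponent_arcRel S
  have hweak : ((x - 1) * (y - 1)) ^ k ∣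
      Polynomial.aeval ((x - 1) * (y - 1)) (weakOrderPoly (D.arcRel S)) := by
    simpa [-Nat.card_eq_fintype_card] using map_dvd (Polynomial.aeval ((x - 1) * (y - 1)))
      (X_pow_card_connectedComponent_dvd_weakOrderPoly (D.arcRel S))
  calc (y - 1) ^ Fintype.card V * (x - 1) ^ D.numComponents
      ∣ (y - 1) ^ (S.card + k) * (x - 1) ^ k :=
        mul_dvd_mul (pow_dvd_pow _ hvert) (pow_dvd_pow _ hcomp)
    _ = (y - 1) ^ S.card * ((x - 1) * (y - 1)) ^ k := by rw [mul_pow, pow_add]; ring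
    _ ∣ _ := mul_dvd_mul_left _ hweak

/-- The sum over all sets of arcs `S` of `y ^ (|E| - |A ∖ S|)` times the strict order polynomial of
`D ∖ S` at `q`. The subtraction truncates only when `D ∖ S` has a cycle, and then the strict order
polynomial vanishes. -/
noncomputable def arcExpansion {R : Type*} [CommRing R] [Algebra ℚ R] (q y : R) : R :=
  ∑ S : Finset A, y ^ (D.numEdges - Sᶜ.card) *
    Polynomial.aeval q (strictOrderPoly (D.delete S).HasArc)

theorem map_arcExpansion {R' : Type*} [CommRing R'] [Algebra ℚ R'] (φ : R →+* R') (q y : R) :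
    φ (D.arcExpansion q y) = D.arcExpansion (φ q) (φ y) := by
  simp [arcExpansion, map_aeval_rat]

theorem eval_arcExpansion_X_C (q y : R) :
    (D.arcExpansion Polynomial.X (Polynomial.C y)).eval q = D.arcExpansion q y := by
  simpa using D.map_arcExpansion (Polynomial.evalRingHom q) Polynomial.X (Polynomial.C y)

open scoped Classical in
theorem arcExpansion_natCast (q : ℕ) (y : R) :
    D.arcExpansion (q : R) y =
      ∑ f : V → Fin q, y ^ (D.nonAscentEdges f).card * (y + 1) ^ D.numAscents f := by
  simp only [pow_mul_pow_numAscents_eq_sum]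
  rw [arcExpansion, Finset.sum_comm]
  refine Finset.sum_congr rfl fun S _ => ?_
  simp [aeval_natCast_strictOrderPoly, D.strict_delete_iff, Fintype.card_subtype, Finset.sum_ite,
    mul_comm]

theorem arcExpansion_neg_one (y : R) :
    D.arcExpansion (-1) y =
      (-1) ^ Fintype.card V * ∑ S ∈ D.acyclicDeletions, y ^ (D.numEdges - Sᶜ.card) := by
  classical
  rw [MultiDigraph.acyclicDeletions, Finset.mul_sum, Finset.sum_filter, arcExpansion]
  refine Finset.sum_congr rfl fun S _ => ?_
  split_ifs with hS
  · rw [aeval_neg_one_strictOrderPoly hS, mul_comm]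
  · rw [strictOrderPoly_eq_zero fun q f hf => hS (forall_not_transGen_of_strict hf), map_zero,
      mul_zero]

end CommRing

section Field

variable {F : Type*} [Field F] [Algebra ℚ F]

theorem pow_numEdges_mul_aeval_bPolynomial (q : F) {y : F} (hy : y ≠ 0) :
    y ^ D.numEdges * MvPolynomial.aeval ![q, 1 / y, 1] D.bPolynomial = D.edgeExpansion q y := by
  classical
  have : CharZero F := algebraRat.charZero F
  have heval (t : F) : (MvPolynomial.aeval ![Polynomial.X, Polynomial.C (1 / y), 1]
      D.bPolynomial).eval t = MvPolynomial.aeval ![t, 1 / y, 1] D.bPolynomial := by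
    have hvec : (fun i => (Polynomial.aeval t).restrictScalars ℚ
        (![Polynomial.X, Polynomial.C (1 / y), 1] i)) = ![t, 1 / y, 1] := by
      funext i; fin_cases i <;> simp
    rw [← hvec, ← MvPolynomial.comp_aeval_apply]
    rfl
  have hpoly : Polynomial.C (y ^ D.numEdges) *
      MvPolynomial.aeval ![Polynomial.X, Polynomial.C (1 / y), 1] D.bPolynomial =
        D.edgeExpansion Polynomial.X (Polynomial.C y) := by
    refine polynomial_eq_of_eval_natCast fun n => ?_
    rw [Polynomial.eval_mul, Polynomial.eval_C, heval, eval_edgeExpansion_X_C,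
      edgeExpansion_natCast, MultiDigraph.aeval_bPolynomial_natCast, Finset.mul_sum]
    refine Finset.sum_congr rfl fun f _ => ?_
    rw [← D.card_nonAscentEdges_add_numAscents f, pow_add, mul_assoc, one_pow, mul_one, ← mul_pow,
      mul_one_div_cancel hy, one_pow, mul_one]
  simpa only [Polynomial.eval_mul, Polynomial.eval_C, heval, eval_edgeExpansion_X_C]
    using congrArg (Polynomial.eval q) hpoly

theorem pow_numEdges_mul_edgeExpansion_div (q : F) {y : F} (hy : y + 1 ≠ 0) :
    (y + 1) ^ D.numEdges * D.edgeExpansion q (y / (y + 1)) = D.arcExpansion q y := by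
  classical
  have : CharZero F := algebraRat.charZero F
  have hpoly : Polynomial.C ((y + 1) ^ D.numEdges) *
      D.edgeExpansion Polynomial.X (Polynomial.C (y / (y + 1))) =
        D.arcExpansion Polynomial.X (Polynomial.C y) := by
    refine polynomial_eq_of_eval_natCast fun n => ?_
    rw [Polynomial.eval_mul, Polynomial.eval_C, eval_edgeExpansion_X_C, eval_arcExpansion_X_C,
      edgeExpansion_natCast, arcExpansion_natCast, Finset.mul_sum]
    refine Finset.sum_congr rfl fun f _ => ?_
    rw [← D.card_nonAscentEdges_add_numAscents f, pow_add, mul_right_comm, ← mul_pow,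
      mul_div_cancel₀ y hy]
  simpa [eval_edgeExpansion_X_C, eval_arcExpansion_X_C] using congrArg (Polynomial.eval q) hpoly

theorem sum_acyclicDeletions_zpow {y : F} (hy : y + 1 ≠ 0) :
    ∑ S ∈ D.acyclicDeletions, y ^ ((D.numEdges : ℤ) - (Sᶜ.card : ℤ)) =
      (-1) ^ Fintype.card V * (y + 1) ^ D.numEdges * D.edgeExpansion (-1) (y / (y + 1)) := by
  classical
  have hsign : (-1 : F) ^ Fintype.card V * (-1) ^ Fintype.card V = 1 := by simp [← mul_pow]
  rw [mul_assoc, D.pow_numEdges_mul_edgeExpansion_div _ hy, arcExpansion_neg_one, ← mul_assoc,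
    hsign, one_mul]
  refine Finset.sum_congr rfl fun S hS => ?_
  rw [← Nat.cast_sub (D.card_compl_le_numEdges (Finset.mem_filter.1 hS).2), zpow_natCast]

end Field

theorem algebraMap_eq_tutteOne {T : MvPolynomial (Fin 2) ℚ}
    (hT : D.edgeExpansion ((MvPolynomial.X 0 - 1) * (MvPolynomial.X 1 - 1)) (MvPolynomial.X 1) =
      (MvPolynomial.X 1 - 1) ^ Fintype.card V * (MvPolynomial.X 0 - 1) ^ D.numComponents * T) :
    algebraMap _ (FractionRing (MvPolynomial (Fin 2) ℚ)) T = D.tutteOne := by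
  set φ := algebraMap (MvPolynomial (Fin 2) ℚ) (FractionRing (MvPolynomial (Fin 2) ℚ))
  have hne {P : MvPolynomial (Fin 2) ℚ} (hP : MvPolynomial.eval (fun _ => 2) P ≠ 0) : φ P ≠ 0 :=
    (map_ne_zero_iff φ (IsFractionRing.injective _ _)).2 fun h => hP (by rw [h, map_zero])
  have hX : φ (MvPolynomial.X 0) - 1 ≠ 0 := by
    rw [← map_one φ, ← RingHom.map_sub]
    exact hne (by norm_num)
  have hY : φ (MvPolynomial.X 1) - 1 ≠ 0 := by
    rw [← map_one φ, ← RingHom.map_sub]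
    exact hne (by norm_num)
  have hexp := congrArg φ hT
  simp only [D.map_edgeExpansion, map_mul, map_pow, map_sub, map_one] at hexp
  rw [tutteOne, div_mul_eq_mul_div, D.pow_numEdges_mul_aeval_bPolynomial _ (hne (by norm_num)),
    hexp, mul_div_cancel_left₀ _ (mul_ne_zero (pow_ne_zero _ hY) (pow_ne_zero _ hX))]

end EdgeExpansion

end MixedGraph

/-- For a mixed graph `D`, the rational function `T⁽¹⁾_D(x, y)` is a polynomial `T`, and
`(y+1)^(|E|+c(D)-|V|) T(y+2, y/(y+1)) = ∑_{S ⊆ A, D ∖ S acyclic} y^(|E|-|A ∖ S|)`.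
The identity is stated for `y` in any field of characteristic zero with `y ≠ -1`; the field
`ℚ(y)` of rational functions gives the identity with `y` an indeterminate. -/
theorem theorem7p6 {V A : Type*} [Fintype V] [Fintype A] [DecidableEq A] (D : MixedGraph V A) :
    ∃ T : MvPolynomial (Fin 2) ℚ,
      algebraMap (MvPolynomial (Fin 2) ℚ) (FractionRing (MvPolynomial (Fin 2) ℚ)) T =
        D.tutteOne ∧
      ∀ (K : Type*) [Field K] [CharZero K] (y : K), y + 1 ≠ 0 →
        (y + 1) ^ ((D.numEdges : ℤ) + (D.numComponents : ℤ) - (Fintype.card V : ℤ)) *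
            MvPolynomial.aeval ![y + 2, y / (y + 1)] T =
          ∑ S ∈ D.acyclicDeletions, y ^ ((D.numEdges : ℤ) - (Sᶜ.card : ℤ)) := by
  obtain ⟨T, hT⟩ := D.pow_mul_pow_dvd_edgeExpansion (MvPolynomial.X 0 : MvPolynomial (Fin 2) ℚ)
    (MvPolynomial.X 1)
  refine ⟨T, D.algebraMap_eq_tutteOne hT, fun K _ _ y hy => ?_⟩
  have hx : y + 2 - 1 = y + 1 := by ring
  have hz : y / (y + 1) - 1 = -(y + 1)⁻¹ := by field_simp; ring
  have hq : (y + 1) * -(y + 1)⁻¹ = -1 := by field_simp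
  have hexp : D.edgeExpansion (-1) (y / (y + 1)) =
      (-(y + 1)⁻¹) ^ Fintype.card V * (y + 1) ^ D.numComponents *
        MvPolynomial.aeval ![y + 2, y / (y + 1)] T := by
    have h := congrArg (MvPolynomial.aeval ![y + 2, y / (y + 1)]).toRingHom hT
    simpa [D.map_edgeExpansion, hx, hz, hq] using h
  have hsign : (-1 : K) ^ Fintype.card V * (-(y + 1)⁻¹) ^ Fintype.card V =
      ((y + 1) ^ Fintype.card V)⁻¹ := by simp [← mul_pow]
  rw [D.sum_acyclicDeletions_zpow hy, hexp, zpow_sub₀ hy, zpow_add₀ hy, div_eq_mul_inv]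
  simp only [zpow_natCast, ← hsign]
  ring
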